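/- For $d \in \mathbb{N}$, let $\|\cdot\|$ be the Euclidean norm on $\mathbb{R}^d$. For finite Borel measures $\mu, \nu$ on $\mathbb{R}^d$ with $\mu(\mathbb{R}^d) = \nu(\mathbb{R}^d)$ and $p \geq 1$, the Wasserstein distance of order $p$ is $$W_p(\mu,\nu) = \Bigl( \inf_{\pi} \int_{\mathbb{R}^d \times \mathbb{R}^d} \|x-y\|^p \, \pi(dx,dy) \Bigr)^{1/p} \in [0,\infty],$$ where the infimum (which is in fact a minimum) is taken over all transport plans between $\mu$ and $\nu$, i.e. all Borel measures $\pi$ on $\mathbb{R}^d \times \mathbb{R}^d$ with $\pi(A \times \mathbb{R}^d) = \mu(A)$ and $\pi(\mathbb{R}^d \times A) = \nu(A)$ for every Borel set $A \subset \mathbb{R}^d$. **Lemma.** Let $\mu, \nu, \alpha$ be finite Borel measures on $\mathbb{R}^d$ with $\mu(\mathbb{R}^d) = \nu(\mathbb{R}^d)$. Then 1. $W_p(\alpha + \mu, \alpha + \nu) \leq W_p(\mu,\nu)$ for every real $p \geq 1$; 2. $W_1(\alpha + \mu, \alpha + \nu) = W_1(\mu,\nu)$ if $W_1(\mu,\nu)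 < \infty$; 3. $W_p(c\mu, c\nu) = c^{1/p}\, W_p(\mu,\nu)$ for every real $p \geq 1$ and every real $c > 0$ (with $c^{1/p} \cdot \infty = \infty$). -/

import Mathlib

open MeasureTheory
open scoped ENNReal NNReal

/-- `π` is a transport plan (coupling) between `μ` and `ν`: a Borel measure on `ℝ^d × ℝ^d` whose
marginals are `μ` and `ν`. -/
structure IsTransportPlan {d : ℕ}
    (π : Measure (EuclideanSpace ℝ (Fin d) × EuclideanSpace ℝ (Fin d)))
    (μ ν : Measure (EuclideanSpace ℝ (Fin d))) : Prop where
  fst_marginal : ∀ A : Set (EuclideanSpace ℝ (Fin d)), MeasurableSet A → π (A ×ˢ Set.univ) = μ A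
  snd_marginal : ∀ A : Set (EuclideanSpace ℝ (Fin d)), MeasurableSet A → π (Set.univ ×ˢ A) = ν A

/-- The transport cost `∫ ‖x - y‖ ^ p π(dx, dy)`, with values in `[0, ∞]`. -/
noncomputable def transportCost {d : ℕ} (p : ℝ)
    (π : Measure (EuclideanSpace ℝ (Fin d) × EuclideanSpace ℝ (Fin d))) : ℝ≥0∞ :=
  ∫⁻ z, ENNReal.ofReal (‖z.1 - z.2‖ ^ p) ∂π

/-- The Wasserstein distance `W_p(μ, ν)` of order `p`, with values in `[0, ∞]`: the `p`-th root of
the minimal (infimal) transport cost over all transport plans between `μ` and `ν`. -/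
noncomputable def wassersteinDist {d : ℕ} (p : ℝ)
    (μ ν : Measure (EuclideanSpace ℝ (Fin d))) : ℝ≥0∞ :=
  (⨅ (π : Measure (EuclideanSpace ℝ (Fin d) × EuclideanSpace ℝ (Fin d)))
    (_ : IsTransportPlan π μ ν), transportCost p π) ^ (1 / p)

open ProbabilityTheory Filter
open scoped Topology

/-! ### Removing common mass from a transport plan -/

section Coupling

variable {E : Type*} [MeasurableSpace E]

/-! Adding `α` on the diagonal of a plan is free, and scaling a plan scales its cost. The substance
is the reverse inequality for `p = 1`. Disintegrate a plan from `α + μ` to `α + ν` into a kernel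
`K`. Start particles from `μ`, move them by `K`, and at each arrival continue or stop with the
densities of `α` and `ν` in `α + ν`. The occupation measure of moving particles stays below `α + μ`
(`sum_survivingLaw_snd_le`), a fixed point of "move, keep the `α` share, add `μ`". Hence the moving
mass dies out, the stopped particles have law `ν`, and by the triangle inequality the total cost is
at most that of the plan (`exists_coupling_of_coupling_add`). -/

/-- Move the second coordinate of a random pair by one step of the kernel `K`. -/
noncomputable def moveSnd (K : Kernel E E) (ρ : Measure (E × E)) : Measure (E × E) :=
  ρ.bind (Kernel.id ∥ₖ K)

/-- The joint law of the starting point and the current position, restricted to the particles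
still moving after `n` steps, of a chain started from `μ` with transition kernel `K` which after
each step goes on moving with probability `f` of its current position. -/
noncomputable def survivingLaw (K : Kernel E E) (f : E → ℝ≥0∞) (μ : Measure E) :
    ℕ → Measure (E × E)
  | 0 => μ.map fun x => (x, x)
  | n + 1 => (moveSnd K (survivingLaw K f μ n)).withDensity fun z => f z.2

/-- The joint law of the starting point and the final position of the particles that stop at step
`n + 1` in the chain of `survivingLaw`. -/
noncomputable def stoppedLaw (K : Kernel E E) (f h : E → ℝ≥0∞) (μ : Measure E) (n : ℕ) :
    Measure (E × E) :=
  (moveSnd K (survivingLaw K f μ n)).withDensity fun z => h z.2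

lemma lintegral_moveSnd (K : Kernel E E) [IsMarkovKernel K] (ρ : Measure (E × E))
    {g : E × E → ℝ≥0∞} (hg : Measurable g) :
    ∫⁻ z, g z ∂moveSnd K ρ = ∫⁻ z, ∫⁻ y, g (z.1, y) ∂K z.2 ∂ρ := by
  rw [moveSnd, Measure.lintegral_bind (Kernel.aemeasurable _) hg.aemeasurable]
  refine lintegral_congr fun z => ?_
  rw [Kernel.lintegral_parallelComp _ hg, Kernel.id_apply, lintegral_dirac']
  exact hg.lintegral_prod_right'

lemma measurable_lintegral_kernel_prodMk (K : Kernel E E) [IsMarkovKernel K]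
    {g : E × E → ℝ≥0∞} (hg : Measurable g) :
    Measurable fun y => ∫⁻ z, g (y, z) ∂K y :=
  hg.lintegral_kernel_prod_right'

variable {K : Kernel E E} {f h : E → ℝ≥0∞} {μ : Measure E}

lemma lintegral_survivingLaw_zero {g : E × E → ℝ≥0∞} (hg : Measurable g) :
    ∫⁻ z, g z ∂survivingLaw K f μ 0 = ∫⁻ x, g (x, x) ∂μ :=
  lintegral_map hg (by fun_prop)

lemma lintegral_survivingLaw_succ (hf : Measurable f) (n : ℕ) {g : E × E → ℝ≥0∞}
    (hg : Measurable g) :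
    ∫⁻ z, g z ∂survivingLaw K f μ (n + 1) =
      ∫⁻ z, f z.2 * g z ∂moveSnd K (survivingLaw K f μ n) :=
  lintegral_withDensity_eq_lintegral_mul _ (hf.comp measurable_snd) hg

lemma lintegral_stoppedLaw (hh : Measurable h) (n : ℕ) {g : E × E → ℝ≥0∞}
    (hg : Measurable g) :
    ∫⁻ z, g z ∂stoppedLaw K f h μ n = ∫⁻ z, h z.2 * g z ∂moveSnd K (survivingLaw K f μ n) :=
  lintegral_withDensity_eq_lintegral_mul _ (hh.comp measurable_snd) hg

lemma lintegral_survivingLaw_succ_add_stoppedLaw (hf : Measurable f) (hh : Measurable h)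
    (hfh : ∀ x, f x + h x = 1) (n : ℕ) {g : E × E → ℝ≥0∞} (hg : Measurable g) :
    ∫⁻ z, g z ∂survivingLaw K f μ (n + 1) + ∫⁻ z, g z ∂stoppedLaw K f h μ n =
      ∫⁻ z, g z ∂moveSnd K (survivingLaw K f μ n) := by
  rw [lintegral_survivingLaw_succ hf n hg, lintegral_stoppedLaw hh n hg,
    ← lintegral_add_left (by fun_prop)]
  refine lintegral_congr fun z => ?_
  rw [← add_mul, hfh, one_mul]

variable [IsMarkovKernel K]

/-- The starting points are preserved: the particles stopped so far and those still moving
together have law `μ` at time zero. -/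
lemma survivingLaw_add_sum_stoppedLaw_fst (hf : Measurable f) (hh : Measurable h)
    (hfh : ∀ x, f x + h x = 1) {g : E → ℝ≥0∞} (hg : Measurable g) (n : ℕ) :
    ∫⁻ z, g z.1 ∂survivingLaw K f μ n +
      ∑ k ∈ Finset.range n, ∫⁻ z, g z.1 ∂stoppedLaw K f h μ k = ∫⁻ x, g x ∂μ := by
  have hg1 : Measurable fun z : E × E => g z.1 := by fun_prop
  induction n with
  | zero => simpa using lintegral_survivingLaw_zero hg1
  | succ n ih =>
    rw [Finset.sum_range_succ, add_comm (∑ k ∈ _, _), ← add_assoc,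
      lintegral_survivingLaw_succ_add_stoppedLaw hf hh hfh n hg1, lintegral_moveSnd K _ hg1, ← ih]
    simp

/-- The cost of the displacement so far is at most the sum of the costs of the steps. -/
lemma survivingLaw_add_sum_stoppedLaw_cost_le (hf : Measurable f) (hh : Measurable h)
    (hfh : ∀ x, f x + h x = 1) {c : E × E → ℝ≥0∞} (hc : Measurable c)
    (hc_self : ∀ x, c (x, x) = 0) (hc_triangle : ∀ x y z, c (x, z) ≤ c (x, y) + c (y, z))
    (n : ℕ) :
    ∫⁻ z, c z ∂survivingLaw K f μ n + ∑ k ∈ Finset.range n, ∫⁻ z, c z ∂stoppedLaw K f h μ k ≤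
      ∑ k ∈ Finset.range n, ∫⁻ z, ∫⁻ y, c (z.2, y) ∂K z.2 ∂survivingLaw K f μ k := by
  induction n with
  | zero => simp [lintegral_survivingLaw_zero hc, hc_self]
  | succ n ih =>
    rw [Finset.sum_range_succ, add_comm (∑ k ∈ _, ∫⁻ z, c z ∂_), ← add_assoc,
      lintegral_survivingLaw_succ_add_stoppedLaw hf hh hfh n hc, lintegral_moveSnd K _ hc,
      Finset.sum_range_succ]
    have step : ∫⁻ z, ∫⁻ y, c (z.1, y) ∂K z.2 ∂survivingLaw K f μ n ≤
        ∫⁻ z, c z ∂survivingLaw K f μ n +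
          ∫⁻ z, ∫⁻ y, c (z.2, y) ∂K z.2 ∂survivingLaw K f μ n := by
      rw [← lintegral_add_left hc]
      refine lintegral_mono fun z => ?_
      calc ∫⁻ y, c (z.1, y) ∂K z.2
          ≤ ∫⁻ y, (c z + c (z.2, y)) ∂K z.2 := lintegral_mono fun y => hc_triangle _ _ _
        _ = c z + ∫⁻ y, c (z.2, y) ∂K z.2 := by
          rw [lintegral_add_left measurable_const]; simp
    calc _ ≤ (∫⁻ z, c z ∂survivingLaw K f μ n +
          ∫⁻ z, ∫⁻ y, c (z.2, y) ∂K z.2 ∂survivingLaw K f μ n) +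
            ∑ k ∈ Finset.range n, ∫⁻ z, c z ∂stoppedLaw K f h μ k := by gcongr
      _ = (∫⁻ z, c z ∂survivingLaw K f μ n +
            ∑ k ∈ Finset.range n, ∫⁻ z, c z ∂stoppedLaw K f h μ k) +
          ∫⁻ z, ∫⁻ y, c (z.2, y) ∂K z.2 ∂survivingLaw K f μ n := by ring
      _ ≤ _ := by gcongr

variable {ν α : Measure E} {π : Measure (E × E)}

/-- The expected occupation measure of the moving particles is at most `α + μ`, if `K`
disintegrates a transport plan from `α + μ` to `α + ν` and `f` is the density of `α` with respect
to `α + ν`. -/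
lemma sum_survivingLaw_snd_le
    (hK : ∀ g : E × E → ℝ≥0∞, Measurable g →
      ∫⁻ y, ∫⁻ z, g (y, z) ∂K y ∂(α + μ) = ∫⁻ z, g z ∂π)
    (hπ : π.snd = α + ν) (hf : Measurable f) (hfα : (α + ν).withDensity f = α) (n : ℕ)
    {g : E → ℝ≥0∞} (hg : Measurable g) :
    ∑ k ∈ Finset.range n, ∫⁻ z, g z.2 ∂survivingLaw K f μ k ≤ ∫⁻ x, g x ∂(α + μ) := by
  induction n generalizing g with
  | zero => simp
  | succ n ih =>
    have hg2 : Measurable fun z : E × E => g z.2 := by fun_prop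
    have hfg : Measurable fun z : E × E => f z.2 * g z.2 := by fun_prop
    -- The time-zero term accounts for `μ`; the later terms must fit under `α`. The induction
    -- hypothesis is applied to one step of `K` weighted by `f`: it carries `α + μ` to `α + ν`, of
    -- which `f` keeps `α`.
    rw [Finset.sum_range_succ', lintegral_survivingLaw_zero hg2, lintegral_add_measure]
    gcongr
    have hsucc : ∀ k, ∫⁻ z, g z.2 ∂survivingLaw K f μ (k + 1) =
        ∫⁻ z, ∫⁻ y, f y * g y ∂K z.2 ∂survivingLaw K f μ k := fun k => by
      rw [lintegral_survivingLaw_succ hf k hg2, lintegral_moveSnd K _ hfg]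
    simp_rw [hsucc]
    refine (ih (measurable_lintegral_kernel_prodMk K hfg)).trans_eq ?_
    rw [hK _ hfg, ← lintegral_map (f := fun x => f x * g x) (by fun_prop) measurable_snd]
    change ∫⁻ x, f x * g x ∂π.snd = _
    rw [hπ]
    conv_rhs => rw [← hfα]
    exact (lintegral_withDensity_eq_lintegral_mul _ hf hg).symm

/-- A finite measure dominated by `α + ν` splits `1` into densities of `α` and of `ν`. -/
lemma exists_complementary_densities (α ν : Measure E) [IsFiniteMeasure α] [IsFiniteMeasure ν] :
    ∃ f h : E → ℝ≥0∞, Measurable f ∧ Measurable h ∧ (∀ x, f x + h x = 1) ∧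
      (α + ν).withDensity f = α ∧ (α + ν).withDensity h = ν := by
  have hle : α ≤ α + ν := Measure.le_add_right le_rfl
  have hmeas := α.measurable_rnDeriv (α + ν)
  -- Truncating at `1` changes the density only on a null set, and makes the two densities sum to
  -- `1` everywhere.
  have hf : Measurable fun x => min (α.rnDeriv (α + ν) x) 1 := hmeas.min measurable_const
  have hα : (α + ν).withDensity (fun x => min (α.rnDeriv (α + ν) x) 1) = α := by
    conv_rhs => rw [← Measure.withDensity_rnDeriv_eq α (α + ν) hle.absolutelyContinuous]
    refine withDensity_congr_ae ?_
    filter_upwards [Measure.rnDeriv_le_one_of_le hle] with x hx using min_eq_left hx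
  have hsum : ∀ x, min (α.rnDeriv (α + ν) x) 1 + (1 - min (α.rnDeriv (α + ν) x) 1) = 1 :=
    fun x => add_tsub_cancel_of_le (min_le_right _ _)
  refine ⟨_, _, hf, hf.const_sub 1, hsum, hα, ?_⟩
  have key : α + (α + ν).withDensity (fun x => 1 - min (α.rnDeriv (α + ν) x) 1) = α + ν := by
    conv_lhs => enter [1]; rw [← hα]
    rw [← withDensity_add_left hf]
    conv_rhs => rw [← withDensity_one (μ := α + ν)]
    exact congrArg _ (funext hsum)
  ext s hs
  have := congrArg (fun m : Measure E => m s) key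
  simp only [Measure.add_apply] at this
  exact (ENNReal.add_right_inj (measure_ne_top α s)).1 this

/-- For a cost satisfying the triangle inequality, mass common to source and target can be removed
from a transport plan without increasing its cost: follow the plan repeatedly, stopping at each
arrival with probability the density of `ν` in `α + ν`. -/
theorem exists_coupling_of_coupling_add [StandardBorelSpace E] [Nonempty E]
    [IsFiniteMeasure μ] [IsFiniteMeasure ν] [IsFiniteMeasure α]
    (hmass : μ Set.univ = ν Set.univ) (hπ_fst : π.fst = α + μ) (hπ_snd : π.snd = α + ν)
    {c : E × E → ℝ≥0∞} (hc : Measurable c) (hc_self : ∀ x, c (x, x) = 0)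
    (hc_triangle : ∀ x y z, c (x, z) ≤ c (x, y) + c (y, z)) :
    ∃ θ : Measure (E × E), θ.fst = μ ∧ θ.snd = ν ∧ ∫⁻ z, c z ∂θ ≤ ∫⁻ z, c z ∂π := by
  have : IsFiniteMeasure π := ⟨by
    rw [← Measure.fst_univ, hπ_fst]; exact measure_lt_top _ _⟩
  have hK : ∀ g : E × E → ℝ≥0∞, Measurable g →
      ∫⁻ y, ∫⁻ z, g (y, z) ∂π.condKernel y ∂(α + μ) = ∫⁻ z, g z ∂π := fun g hg => by
    rw [← hπ_fst, Measure.lintegral_condKernel hg]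
  obtain ⟨f, h, hf, hh, hfh, hfα, hhν⟩ := exists_complementary_densities α ν
  set K := π.condKernel
  have hocc : ∀ g : E → ℝ≥0∞, Measurable g →
      ∑' k, ∫⁻ z, g z.2 ∂survivingLaw K f μ k ≤ ∫⁻ x, g x ∂(α + μ) := fun g hg =>
    ENNReal.tsum_le_of_sum_range_le fun n => sum_survivingLaw_snd_le hK hπ_snd hf hfα n hg
  -- The expected number of steps is bounded by the finite mass of `α + μ`, so no starting mass
  -- moves forever.
  have hvanish : Tendsto (fun n => survivingLaw K f μ n Set.univ) atTop (𝓝 0) := by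
    refine ENNReal.tendsto_atTop_zero_of_tsum_ne_top (ne_top_of_le_ne_top
      (measure_ne_top (α + μ) Set.univ) ?_)
    simpa using hocc (fun _ => 1) measurable_const
  have hfst : (Measure.sum (stoppedLaw K f h μ)).fst = μ := by
    ext s hs
    have hinv := survivingLaw_add_sum_stoppedLaw_fst (K := K) (μ := μ) hf hh hfh
      (measurable_one.indicator hs)
    have hind : ∀ ρ : Measure (E × E),
        ∫⁻ z, s.indicator 1 z.1 ∂ρ = ρ (Prod.fst ⁻¹' s) := fun ρ => by
      rw [← lintegral_indicator_one (measurable_fst hs)]; rfl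
    simp only [hind, lintegral_indicator_one hs] at hinv
    rw [Measure.fst_apply hs, Measure.sum_apply _ (measurable_fst hs)]
    have h0 : Tendsto (fun n => survivingLaw K f μ n (Prod.fst ⁻¹' s)) atTop (𝓝 0) :=
      tendsto_of_tendsto_of_tendsto_of_le_of_le tendsto_const_nhds hvanish
        (fun _ => zero_le) (fun _ => measure_mono (Set.subset_univ _))
    have hlim := h0.add
      (ENNReal.summable (f := fun k => stoppedLaw K f h μ k (Prod.fst ⁻¹' s))).tendsto_sum_tsum_nat
    simp only [hinv, zero_add] at hlim
    exact tendsto_nhds_unique hlim tendsto_const_nhds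
  -- The occupation bound gives only an inequality; equality of total masses then forces equality of
  -- measures.
  have hsnd_le : (Measure.sum (stoppedLaw K f h μ)).snd ≤ ν := by
    refine Measure.le_iff.2 fun s hs => ?_
    have hg : Measurable fun z : E × E => h z.2 * s.indicator 1 z.2 :=
      (hh.comp measurable_snd).mul ((measurable_one.indicator hs).comp measurable_snd)
    have hg2 : Measurable fun z : E × E => s.indicator (1 : E → ℝ≥0∞) z.2 :=
      (measurable_one.indicator hs).comp measurable_snd
    have hg' : Measurable fun x => h x * s.indicator 1 x := hh.mul (measurable_one.indicator hs)
    rw [Measure.snd_apply hs, Measure.sum_apply _ (measurable_snd hs)]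
    calc ∑' k, stoppedLaw K f h μ k (Prod.snd ⁻¹' s)
        = ∑' k, ∫⁻ z, ∫⁻ y, h y * s.indicator 1 y ∂K z.2 ∂survivingLaw K f μ k := by
          refine tsum_congr fun k => ?_
          rw [← lintegral_moveSnd K _ hg, ← lintegral_stoppedLaw hh k hg2,
            ← lintegral_indicator_one (measurable_snd hs)]
          rfl
      _ ≤ ∫⁻ x, ∫⁻ y, h y * s.indicator 1 y ∂K x ∂(α + μ) :=
          hocc _ (measurable_lintegral_kernel_prodMk K hg)
      _ = ∫⁻ x, h x * s.indicator 1 x ∂π.snd := by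
          rw [hK _ hg]; exact (lintegral_map hg' measurable_snd).symm
      _ = ν s := by
          rw [hπ_snd, ← lintegral_indicator_one hs]
          conv_rhs => rw [← hhν]
          exact (lintegral_withDensity_eq_lintegral_mul _ hh (measurable_one.indicator hs)).symm
  have huniv : (Measure.sum (stoppedLaw K f h μ)).snd Set.univ = ν Set.univ := by
    rw [Measure.snd_univ, ← Measure.fst_univ, hfst, hmass]
  have : IsFiniteMeasure (Measure.sum (stoppedLaw K f h μ)).snd :=
    ⟨by rw [huniv]; exact measure_lt_top _ _⟩
  refine ⟨_, hfst, Measure.eq_of_le_of_measure_univ_eq hsnd_le huniv, ?_⟩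
  rw [lintegral_sum_measure]
  refine ENNReal.tsum_le_of_sum_range_le fun n => ?_
  calc ∑ k ∈ Finset.range n, ∫⁻ z, c z ∂stoppedLaw K f h μ k
      ≤ _ := le_add_self
    _ ≤ _ := survivingLaw_add_sum_stoppedLaw_cost_le hf hh hfh hc hc_self hc_triangle n
    _ ≤ ∑' k, ∫⁻ z, ∫⁻ y, c (z.2, y) ∂K z.2 ∂survivingLaw K f μ k := ENNReal.sum_le_tsum _
    _ ≤ ∫⁻ x, ∫⁻ y, c (x, y) ∂K x ∂(α + μ) := hocc _ (measurable_lintegral_kernel_prodMk K hc)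
    _ = ∫⁻ z, c z ∂π := hK c hc

end Coupling

/-! ### Consequences for the Wasserstein distance -/

section Wasserstein

variable {d : ℕ} {μ ν α : Measure (EuclideanSpace ℝ (Fin d))}
  {π : Measure (EuclideanSpace ℝ (Fin d) × EuclideanSpace ℝ (Fin d))}

lemma isTransportPlan_iff : IsTransportPlan π μ ν ↔ π.fst = μ ∧ π.snd = ν := by
  constructor
  · rintro ⟨h1, h2⟩
    refine ⟨Measure.ext fun s hs => ?_, Measure.ext fun s hs => ?_⟩
    · rw [Measure.fst_apply hs, ← Set.prod_univ, h1 s hs]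
    · rw [Measure.snd_apply hs, ← Set.univ_prod, h2 s hs]
  · rintro ⟨rfl, rfl⟩
    refine ⟨fun s hs => ?_, fun s hs => ?_⟩
    · rw [Measure.fst_apply hs, Set.prod_univ]
    · rw [Measure.snd_apply hs, Set.univ_prod]

lemma measurable_transportCost_integrand (p : ℝ) :
    Measurable fun z : EuclideanSpace ℝ (Fin d) × EuclideanSpace ℝ (Fin d) =>
      ENNReal.ofReal (‖z.1 - z.2‖ ^ p) := by
  fun_prop

lemma IsTransportPlan.add_diagonal (hπ : IsTransportPlan π μ ν)
    (α : Measure (EuclideanSpace ℝ (Fin d))) :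
    IsTransportPlan (α.map (fun x => (x, x)) + π) (α + μ) (α + ν) := by
  have hdiag : Measurable fun x : EuclideanSpace ℝ (Fin d) => (x, x) := by fun_prop
  refine ⟨fun A hA => ?_, fun A hA => ?_⟩
  · rw [Measure.add_apply, Measure.add_apply, hπ.fst_marginal A hA,
      Measure.map_apply hdiag (hA.prod .univ)]
    simp [Set.preimage]
  · rw [Measure.add_apply, Measure.add_apply, hπ.snd_marginal A hA,
      Measure.map_apply hdiag (MeasurableSet.univ.prod hA)]
    simp [Set.preimage]

lemma transportCost_add_diagonal {p : ℝ} (hp : 1 ≤ p) :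
    transportCost p (α.map (fun x => (x, x)) + π) = transportCost p π := by
  -- This needs `p ≠ 0`, since `0 ^ 0 = 1` would charge the diagonal.
  have h0 : (0 : ℝ) ^ p = 0 := Real.zero_rpow (by linarith)
  rw [transportCost, lintegral_add_measure,
    lintegral_map (measurable_transportCost_integrand p) (by fun_prop)]
  simp [h0, transportCost]

theorem wassersteinDist_add_left_le {p : ℝ} (hp : 1 ≤ p) :
    wassersteinDist p (α + μ) (α + ν) ≤ wassersteinDist p μ ν := by
  refine ENNReal.rpow_le_rpow (le_iInf₂ fun π hπ => ?_) (by positivity)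
  exact (iInf₂_le (α.map (fun x => (x, x)) + π) (hπ.add_diagonal α)).trans_eq
    (transportCost_add_diagonal hp)

theorem wassersteinDist_one_le_add_left [IsFiniteMeasure μ] [IsFiniteMeasure ν]
    [IsFiniteMeasure α] (hmass : μ Set.univ = ν Set.univ) :
    wassersteinDist 1 μ ν ≤ wassersteinDist 1 (α + μ) (α + ν) := by
  refine ENNReal.rpow_le_rpow (le_iInf₂ fun π hπ => ?_) (by norm_num)
  obtain ⟨hπ1, hπ2⟩ := isTransportPlan_iff.1 hπ
  obtain ⟨θ, hθ1, hθ2, hθ⟩ := exists_coupling_of_coupling_add hmass hπ1 hπ2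
    (measurable_transportCost_integrand 1) (by simp) (fun x y z => by
      simp only [Real.rpow_one]
      rw [← ENNReal.ofReal_add (norm_nonneg _) (norm_nonneg _)]
      exact ENNReal.ofReal_le_ofReal (norm_sub_le_norm_sub_add_norm_sub x y z))
  exact (iInf₂_le θ (isTransportPlan_iff.2 ⟨hθ1, hθ2⟩)).trans hθ

lemma IsTransportPlan.smul (hπ : IsTransportPlan π μ ν) (c : ℝ≥0) :
    IsTransportPlan (c • π) (c • μ) (c • ν) :=
  ⟨fun A hA => by simp [hπ.fst_marginal A hA], fun A hA => by simp [hπ.snd_marginal A hA]⟩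

lemma wassersteinDist_smul_le {p : ℝ} (hp : 0 < p) (c : ℝ≥0) (hc : 0 < c) :
    wassersteinDist p (c • μ) (c • ν) ≤ (c : ℝ≥0∞) ^ (1 / p) * wassersteinDist p μ ν := by
  have hp' : 0 ≤ 1 / p := by positivity
  rw [wassersteinDist, wassersteinDist, ← ENNReal.mul_rpow_of_nonneg _ _ hp']
  refine ENNReal.rpow_le_rpow ?_ hp'
  have hc0 : (c : ℝ≥0∞) ≠ 0 := by exact_mod_cast hc.ne'
  simp_rw [ENNReal.mul_iInf_of_ne hc0 ENNReal.coe_ne_top]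
  refine le_iInf₂ fun π hπ => (iInf₂_le (c • π) (hπ.smul c)).trans_eq ?_
  rw [transportCost, lintegral_smul_measure, ENNReal.smul_def, smul_eq_mul, transportCost]

/-- The reverse bound is the upper bound applied to the scaled measures with factor `c⁻¹`. -/
theorem wassersteinDist_smul {p : ℝ} (hp : 0 < p) (c : ℝ≥0) (hc : 0 < c) :
    wassersteinDist p (c • μ) (c • ν) = (c : ℝ≥0∞) ^ (1 / p) * wassersteinDist p μ ν := by
  refine le_antisymm (wassersteinDist_smul_le hp c hc) ?_
  have hinv := wassersteinDist_smul_le (μ := c • μ) (ν := c • ν) hp c⁻¹ (inv_pos.2 hc)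
  rw [inv_smul_smul₀ hc.ne', inv_smul_smul₀ hc.ne'] at hinv
  have hcancel : (c : ℝ≥0∞) ^ (1 / p) * ((c⁻¹ : ℝ≥0) : ℝ≥0∞) ^ (1 / p) = 1 := by
    rw [← ENNReal.mul_rpow_of_nonneg _ _ (by positivity), ← ENNReal.coe_mul,
      mul_inv_cancel₀ hc.ne', ENNReal.coe_one, ENNReal.one_rpow]
  calc (c : ℝ≥0∞) ^ (1 / p) * wassersteinDist p μ ν
      ≤ (c : ℝ≥0∞) ^ (1 / p) *
        (((c⁻¹ : ℝ≥0) : ℝ≥0∞) ^ (1 / p) * wassersteinDist p (c • μ) (c • ν)) := by gcongr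
    _ = wassersteinDist p (c • μ) (c • ν) := by rw [← mul_assoc, hcancel, one_mul]

end Wasserstein

theorem mainTheorem4 (d : ℕ) (μ ν α : Measure (EuclideanSpace ℝ (Fin d)))
    [IsFiniteMeasure μ] [IsFiniteMeasure ν] [IsFiniteMeasure α]
    (hmass : μ Set.univ = ν Set.univ) :
    (∀ p : ℝ, 1 ≤ p → wassersteinDist p (α + μ) (α + ν) ≤ wassersteinDist p μ ν) ∧
    (wassersteinDist 1 μ ν < ∞ → wassersteinDist 1 (α + μ) (α + ν) = wassersteinDist 1 μ ν) ∧
    (∀ p : ℝ, 1 ≤ p → ∀ c : ℝ≥0, 0 < c →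
      wassersteinDist p (c • μ) (c • ν) = (c : ℝ≥0∞) ^ (1 / p) * wassersteinDist p μ ν) := by
  refine ⟨fun p hp => wassersteinDist_add_left_le hp, fun _ => ?_,
    fun p hp c hc => wassersteinDist_smul (by linarith) c hc⟩
  exact le_antisymm (wassersteinDist_add_left_le le_rfl) (wassersteinDist_one_le_add_left hmass)
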